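/- For $s>0$ let $\phi_s$ be a gauge function with $\phi_s(0)=0$ and $\phi_s(x)=(\log(1/x))^{-s}$ for all sufficiently small $x>0$. For $E\subset\mathbb{R}$ let \[ \mathcal{H}^{\phi}(E)=\lim_{\delta\to0}\inf\Bigl\{\sum_i\phi(\operatorname{diam}U_i):\ E\subset\bigcup_iU_i,\ \operatorname{diam}U_i<\delta\Bigr\} \] (the infimum being over countable covers) be the Hausdorff measure with gauge $\phi$, and let \[ \mathcal{P}^{\phi}(E)=\inf\Bigl\{\sum_i\mathcal{P}_0^{\phi}(E_i):\ E\subset\bigcup_iE_i\Bigr\},\qquad \mathcal{P}_0^{\phi}(E)=\lim_{\delta\to0}\sup\sum_i\phi(r_i), \] be the packing measure with gauge $\phi$, where the first infimum is over countable covers and the supremum is over all families of pairwise disjoint closed balls $B(x_i,r_i)$ with $x_i\in E$ and $0<r_i<\delta$. The logarithmic Hausdorff (respectively packing) dimension of $E$ is the infimum of all $s>0$ such that $\mathcal{H}^{\phi_s}(E)=0$ (respectively $\mathcal{P}^{\phi_s}(E)=0$), and is $\infty$ if there is no such $s$. Let $A\subset[0,1]$ be a Borel set whose logarithmic packing dimension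 is $>2$ or whose logarithmic Hausdorff dimension is $>1$. Then there exists an $F_\sigma$ set $B\subset\mathbb{R}$ of Lebesgue measure zero such that \[ f(A)+B=\mathbb{R}\qquad\text{for all non-constant polynomial maps } f:\mathbb{R}\to\mathbb{R}, \] where $f(A)+B=\{f(a)+b:\ a\in A,\ b\in B\}$. -/

import Mathlib

open MeasureTheory Set
open scoped ENNReal Pointwise

noncomputable section

/-- The gauge `x ↦ log^{-s}(1/x)` for `0 < x ≤ 1/2`, with value `0` at `0`, continued by the constant
`log^{-s} 2` for `x ≥ 1/2` (only arbitrarily small `x` matter below). -/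
def logGauge (s x : ℝ) : ℝ :=
  if x ≤ 0 then 0 else Real.log (max x⁻¹ 2) ^ (-s)

/-- The Hausdorff measure `ℋ^φ(A)` of a subset of the line with respect to the gauge `φ`. It is the
limit, as `δ → 0`, of the infimum of `∑ φ(diam U_i)` over countable covers of `A` by sets of
diameter at most `δ`. -/
def gaugeHausdorff (φ : ℝ → ℝ) (A : Set ℝ) : ℝ≥0∞ :=
  Measure.mkMetric (fun t : ℝ≥0∞ => ENNReal.ofReal (φ t.toReal)) A

/-- A `δ`-packing of `E`: a family of pairwise disjoint (closed) balls with centres in `E` and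
radii in `(0, δ)`. A ball is given by the pair (centre, radius). -/
def IsPacking (δ : ℝ) (E : Set ℝ) (P : Set (ℝ × ℝ)) : Prop :=
  (∀ p ∈ P, p.1 ∈ E ∧ 0 < p.2 ∧ p.2 < δ) ∧
    P.PairwiseDisjoint fun p => Metric.closedBall p.1 p.2

/-- The packing pre-measure `𝒫₀^φ(E)`. The supremum decreases with `δ`, so that its limit as
`δ → 0` is the infimum over `δ > 0`. -/
def packingPreMeasure (φ : ℝ → ℝ) (E : Set ℝ) : ℝ≥0∞ :=
  ⨅ (δ : ℝ) (_ : 0 < δ), ⨆ (P : Set (ℝ × ℝ)) (_ : IsPacking δ E P),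
    ∑' p : P, ENNReal.ofReal (φ p.1.2)

/-- The packing (outer) measure `𝒫^φ(A)`. -/
def gaugePacking (φ : ℝ → ℝ) (A : Set ℝ) : ℝ≥0∞ :=
  ⨅ (E : ℕ → Set ℝ) (_ : A ⊆ ⋃ i, E i), ∑' i, packingPreMeasure φ (E i)

/-- The logarithmic Hausdorff dimension: the infimum of all `s > 0` such that the Hausdorff measure
with gauge `log^{-s}(1/x)` of `A` vanishes (`∞` if there is no such `s`). -/
def hausdorffLogDim (A : Set ℝ) : ℝ≥0∞ :=
  ⨅ (s : ℝ) (_ : 0 < s) (_ : gaugeHausdorff (logGauge s) A = 0), ENNReal.ofReal s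

/-- The logarithmic packing dimension: the infimum of all `s > 0` such that the packing measure
with gauge `log^{-s}(1/x)` of `A` vanishes (`∞` if there is no such `s`). -/
def packingLogDim (A : Set ℝ) : ℝ≥0∞ :=
  ⨅ (s : ℝ) (_ : 0 < s) (_ : gaugePacking (logGauge s) A = 0), ENNReal.ofReal s

/-- An `F_σ` set: a countable union of closed sets. -/
def IsFSigma (B : Set ℝ) : Prop :=
  ∃ K : ℕ → Set ℝ, (∀ n, IsClosed (K n)) ∧ B = ⋃ n, K n

end

open Filter Topology Polynomial

/-! Since `t ∈ f(A) + B` exactly when the polynomial `t - f` maps some point of `A` into `B`, it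
suffices that `B` meets `p(A)` for every non-constant polynomial `p`.

The dimension hypothesis enters only through `not_isSigmaLogSparse_of_logDim`: `A` is not a
countable union of sets whose `2⁻ᵠ`-separated subsets have `O(q)` points.

The finite core is `exists_finset_closed_of_not_isLogSparse`. If `E` is not log-sparse, then for
every `N` some `δ = 2⁻ᵠ` admits a `δ`-separated `S ⊆ E` with more than `N q` points. A polynomial of
degree `d` with leading coefficient bounded below sends at most `d` points of `S` into one cell of a
grid of width about `δ ^ d`, so its values on `S` occupy at least `|S| / d` cells. Up to rounding
there are `exp (O(q))` such polynomials, so `exists_hitting_set` gives about `δ⁻ᵈ q / |S|` cells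
meeting all these value sets. Their total length is `O(1 / N)`.

To reach measure zero, the step is iterated along a finitely branching tree of closed balls in a
Polish space parametrising `A`, centred at points where the image is nowhere locally `σ`-log-sparse.
The sets built at successive levels intersect in a closed null set. Each polynomial selects a
branch, whose limit point it maps into that null set. -/

/-- A set of reals is log-sparse if its `2⁻ᵠ`-separated subsets have at most `C q` points. -/
def IsLogSparse (E : Set ℝ) : Prop :=
  ∃ C : ℕ, ∀ q : ℕ, 1 ≤ q → ∀ S : Finset ℝ, (S : Set ℝ) ⊆ E →
    (S : Set ℝ).Pairwise (fun x y => (1 / 2 : ℝ) ^ q ≤ |x - y|) → S.card ≤ C * q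

/-- A set of reals is `σ`-log-sparse if it is covered by countably many log-sparse sets. -/
def IsSigmaLogSparse (E : Set ℝ) : Prop :=
  ∃ e : ℕ → Set ℝ, (∀ i, IsLogSparse (e i)) ∧ E ⊆ ⋃ i, e i

/-! ### Countable stability of `σ`-log-sparseness -/

theorem isLogSparse_empty : IsLogSparse ∅ :=
  ⟨0, fun q _ S hS _ => by
    simp [Finset.coe_eq_empty.1 (subset_empty_iff.1 hS)]⟩

theorem IsLogSparse.isSigmaLogSparse {E : Set ℝ} (h : IsLogSparse E) : IsSigmaLogSparse E :=
  ⟨fun _ => E, fun _ => h, subset_iUnion (fun _ : ℕ => E) 0⟩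

theorem IsSigmaLogSparse.mono {E F : Set ℝ} (hF : IsSigmaLogSparse F) (h : E ⊆ F) :
    IsSigmaLogSparse E := by
  obtain ⟨e, he, hc⟩ := hF
  exact ⟨e, he, h.trans hc⟩

theorem IsSigmaLogSparse.iUnion {E : ℕ → Set ℝ} (h : ∀ i, IsSigmaLogSparse (E i)) :
    IsSigmaLogSparse (⋃ i, E i) := by
  choose e he hc using h
  refine ⟨fun n => e n.unpair.1 n.unpair.2, fun n => he _ _, iUnion_subset fun i x hx => ?_⟩
  obtain ⟨j, hj⟩ := mem_iUnion.1 (hc i hx)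
  exact mem_iUnion.2 ⟨Nat.pair i j, by simpa using hj⟩

theorem IsSigmaLogSparse.union {E F : Set ℝ} (hE : IsSigmaLogSparse E)
    (hF : IsSigmaLogSparse F) : IsSigmaLogSparse (E ∪ F) := by
  refine (IsSigmaLogSparse.iUnion (E := fun n => if n = 0 then E else F) fun i => ?_).mono ?_
  · split_ifs <;> assumption
  · rintro x (hx | hx)
    · exact mem_iUnion.2 ⟨0, by simpa using hx⟩
    · exact mem_iUnion.2 ⟨1, by simpa using hx⟩

theorem IsSigmaLogSparse.biUnion_countable {ι : Type*} {I : Set ι} (hI : I.Countable)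
    {E : ι → Set ℝ} (h : ∀ i ∈ I, IsSigmaLogSparse (E i)) :
    IsSigmaLogSparse (⋃ i ∈ I, E i) := by
  rcases I.eq_empty_or_nonempty with rfl | hne
  · simpa using isLogSparse_empty.isSigmaLogSparse
  · obtain ⟨f, rfl⟩ := hI.exists_eq_range hne
    rw [biUnion_range]
    exact IsSigmaLogSparse.iUnion fun i => h _ ⟨i, rfl⟩

/-! ### Logarithmic dimensions of log-sparse sets -/

theorem logGauge_le {s x : ℝ} {q : ℕ} (hs : 0 < s) (hq : 1 ≤ q) (hx : x ≤ (1 / 2) ^ q) :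
    logGauge s x ≤ (q * Real.log 2) ^ (-s) := by
  have hq' : (0 : ℝ) < q := by exact_mod_cast hq
  have h2 : 0 < Real.log 2 := Real.log_pos one_lt_two
  unfold logGauge
  split_ifs with h
  · positivity
  · push Not at h
    refine Real.rpow_le_rpow_of_nonpos (by positivity) ?_ (by linarith)
    rw [← Real.log_pow]
    refine Real.log_le_log (by positivity) (le_max_of_le_left ?_)
    rw [le_inv_comm₀ (by positivity) h]
    simpa using hx

/-- A separated subset of maximal cardinality is a net; the cardinality bound makes the maximum
exist. -/
theorem IsLogSparse.exists_net {E : Set ℝ} {C : ℕ} {q : ℕ}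
    (h : ∀ S : Finset ℝ, (S : Set ℝ) ⊆ E →
      (S : Set ℝ).Pairwise (fun x y => (1 / 2 : ℝ) ^ q ≤ |x - y|) → S.card ≤ C * q) :
    ∃ S : Finset ℝ, S.card ≤ C * q ∧ E ⊆ ⋃ a ∈ S, Icc (a - (1 / 2) ^ q) (a + (1 / 2) ^ q) := by
  let p : ℕ → Prop := fun n => ∃ S : Finset ℝ, (S : Set ℝ) ⊆ E ∧
    (S : Set ℝ).Pairwise (fun x y => (1 / 2 : ℝ) ^ q ≤ |x - y|) ∧ S.card = n
  have hp0 : p 0 := ⟨∅, by simp, by simp, rfl⟩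
  have hpb : ∀ n, p n → n ≤ C * q := by
    rintro n ⟨S, h1, h2, rfl⟩
    exact h S h1 h2
  classical
  obtain ⟨S, hSE, hSp, hSc⟩ := Nat.findGreatest_spec (P := p) (Nat.zero_le (C * q)) hp0
  refine ⟨S, h S hSE hSp, fun x hx => ?_⟩
  by_contra hcon
  simp only [mem_iUnion, mem_Icc, not_exists, not_and, not_le] at hcon
  have hfar : ∀ a ∈ S, (1 / 2 : ℝ) ^ q ≤ |x - a| := by
    intro a ha
    rw [le_abs]
    by_cases h1 : a - (1 / 2) ^ q ≤ x
    · left; linarith [hcon a ha h1]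
    · right; linarith
  have hxS : x ∉ S := fun hxS => by
    have := hfar x hxS
    rw [sub_self, abs_zero] at this
    have : (0 : ℝ) < (1 / 2) ^ q := by positivity
    linarith
  have hp : p (S.card + 1) := by
    refine ⟨insert x S, ?_, ?_, Finset.card_insert_of_notMem hxS⟩
    · rw [Finset.coe_insert]
      exact insert_subset hx hSE
    · rw [Finset.coe_insert]
      refine hSp.insert fun b hb _ => ⟨hfar b hb, ?_⟩
      rw [abs_sub_comm]
      exact hfar b hb
  have := Nat.le_findGreatest (P := p) (hpb _ hp) hp
  omega

theorem tendsto_mul_rpow_neg {s c : ℝ} (hs : 1 < s) (C : ℝ) (hc : 0 < c) :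
    Tendsto (fun q : ℕ => C * ((q : ℝ) + 1) * (q * c) ^ (-s)) atTop (𝓝 0) := by
  have h1 : Tendsto (fun q : ℕ => (q : ℝ) ^ (-(s - 1))) atTop (𝓝 0) :=
    (tendsto_rpow_neg_atTop (by linarith)).comp tendsto_natCast_atTop_atTop
  have h2 : Tendsto (fun q : ℕ => (q : ℝ) ^ (-s)) atTop (𝓝 0) :=
    (tendsto_rpow_neg_atTop (by linarith)).comp tendsto_natCast_atTop_atTop
  have h3 := ((h1.add h2).const_mul (C * c ^ (-s)))
  rw [add_zero, mul_zero] at h3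
  refine h3.congr' ?_
  filter_upwards [eventually_ge_atTop 1] with q hq
  have hq' : (0 : ℝ) < q := by exact_mod_cast hq
  rw [Real.mul_rpow hq'.le hc.le, neg_sub, sub_eq_add_neg 1 s, Real.rpow_add hq', Real.rpow_one]
  ring

/-- A net gives a cover by `O(q)` intervals of diameter `2⁻ᵠ`, at total cost `O(q ^ (1 - s))`. -/
theorem IsLogSparse.gaugeHausdorff_eq_zero {E : Set ℝ} (h : IsLogSparse E) {s : ℝ} (hs : 1 < s) :
    gaugeHausdorff (logGauge s) E = 0 := by
  obtain ⟨C, hC⟩ := h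
  have hnet : ∀ q : ℕ, ∃ S : Finset ℝ, S.card ≤ C * (q + 1) ∧
      E ⊆ ⋃ a ∈ S, Icc (a - (1 / 2) ^ (q + 1)) (a + (1 / 2) ^ (q + 1)) := fun q =>
    IsLogSparse.exists_net (hC (q + 1) (by omega))
  choose S hSc hSE using hnet
  have hdiam : ∀ (q : ℕ) (a : ℝ), Metric.ediam (Icc (a - (1 / 2) ^ (q + 1)) (a + (1 / 2) ^ (q + 1)))
      = ENNReal.ofReal ((1 / 2) ^ q) := by
    intro q a
    rw [Real.ediam_Icc]
    congr 1
    ring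
  have hle := Measure.mkMetric_le_liminf_sum (ι := fun q : ℕ => S q) E (l := atTop)
    (fun q : ℕ => ENNReal.ofReal ((1 / 2) ^ q)) (by
      rw [← ENNReal.ofReal_zero]
      exact ENNReal.tendsto_ofReal
        (tendsto_pow_atTop_nhds_zero_of_lt_one (by norm_num) (by norm_num)))
    (fun q a => Icc ((a : ℝ) - (1 / 2) ^ (q + 1)) (a + (1 / 2) ^ (q + 1)))
    (Eventually.of_forall fun q a => (hdiam q a).le)
    (Eventually.of_forall fun q => (hSE q).trans_eq (by rw [iUnion_subtype]))
    (fun t : ℝ≥0∞ => ENNReal.ofReal (logGauge s t.toReal))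
  refine le_antisymm (hle.trans ?_) bot_le
  have hlim : Tendsto (fun q : ℕ => ENNReal.ofReal
      (C * ((q : ℝ) + 1) * (q * Real.log 2) ^ (-s))) atTop (𝓝 0) := by
    rw [← ENNReal.ofReal_zero]
    exact ENNReal.tendsto_ofReal (tendsto_mul_rpow_neg hs C (Real.log_pos one_lt_two))
  rw [← hlim.liminf_eq]
  refine liminf_le_liminf ?_
  filter_upwards [eventually_ge_atTop 1] with q hq
  have hterm : ∀ a : S q, ENNReal.ofReal (logGauge s (Metric.ediam
      (Icc ((a : ℝ) - (1 / 2) ^ (q + 1)) (a + (1 / 2) ^ (q + 1)))).toReal) ≤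
      ENNReal.ofReal ((q * Real.log 2) ^ (-s)) := by
    intro a
    rw [hdiam, ENNReal.toReal_ofReal (by positivity)]
    exact ENNReal.ofReal_le_ofReal (logGauge_le (by linarith) hq le_rfl)
  refine (Finset.sum_le_sum fun a _ => hterm a).trans ?_
  rw [Finset.sum_const, nsmul_eq_mul, Finset.card_univ, Fintype.card_coe,
    ENNReal.ofReal_mul (by positivity)]
  gcongr
  rw [← ENNReal.ofReal_natCast]
  refine ENNReal.ofReal_le_ofReal ?_
  exact_mod_cast hSc q

/-- Disjoint balls of radius above `2⁻ᵠ⁻¹` have `2⁻ᵠ`-separated centres, so one dyadic generation of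
a packing contains at most `C q` balls. -/
theorem tsum_le_of_sparse_centres {C q : ℕ} {E : Set ℝ} {s δ : ℝ} (hs : 0 < s) (hq : 1 ≤ q)
    (h : ∀ S : Finset ℝ, (S : Set ℝ) ⊆ E →
      (S : Set ℝ).Pairwise (fun x y => (1 / 2 : ℝ) ^ q ≤ |x - y|) → S.card ≤ C * q)
    {P : Set (ℝ × ℝ)} (hP : IsPacking δ E P) {Q : Set (ℝ × ℝ)} (hQP : Q ⊆ P)
    (hQ : ∀ p ∈ Q, (1 / 2) ^ (q + 1) < p.2 ∧ p.2 ≤ (1 / 2) ^ q) :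
    ∑' p : Q, ENNReal.ofReal (logGauge s (p : ℝ × ℝ).2) ≤
      ENNReal.ofReal (C * q * (q * Real.log 2) ^ (-s)) := by
  have hsep : ∀ p ∈ Q, ∀ p' ∈ Q, p ≠ p' → (1 / 2 : ℝ) ^ q ≤ |p.1 - p'.1| := by
    intro p hp p' hp' hne
    have hd := hP.2 (hQP hp) (hQP hp') hne
    simp only [Function.onFun, Real.closedBall_eq_Icc] at hd
    by_contra hcon
    push Not at hcon
    obtain ⟨hp1, -⟩ := hQ p hp
    obtain ⟨hp2, -⟩ := hQ p' hp'
    have hh : (1 / 2 : ℝ) ^ q = 2 * (1 / 2) ^ (q + 1) := by ring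
    rw [abs_lt] at hcon
    have h0 : (0 : ℝ) < (1 / 2) ^ (q + 1) := by positivity
    have hm : (p.1 + p'.1) / 2 ∈ Icc (p.1 - p.2) (p.1 + p.2) := ⟨by linarith, by linarith⟩
    exact Set.disjoint_left.1 hd hm ⟨by linarith, by linarith⟩
  rw [ENNReal.tsum_eq_iSup_sum]
  refine iSup_le fun F => ?_
  classical
  have hcard : F.card ≤ C * q := by
    have hinj : Function.Injective fun p : Q => (p : ℝ × ℝ).1 := by
      intro p p' hpp
      by_contra hne
      have := hsep p p.2 p' p'.2 (fun h => hne (Subtype.ext h))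
      simp only at hpp
      rw [hpp, sub_self, abs_zero] at this
      have : (0 : ℝ) < (1 / 2) ^ q := by positivity
      linarith
    rw [← Finset.card_image_of_injective F hinj]
    refine h _ ?_ ?_
    · intro x hx
      obtain ⟨p, -, rfl⟩ := Finset.mem_image.1 (Finset.mem_coe.1 hx)
      exact (hP.1 p (hQP p.2)).1
    · intro x hx y hy hxy
      obtain ⟨p, -, rfl⟩ := Finset.mem_image.1 (Finset.mem_coe.1 hx)
      obtain ⟨p', -, rfl⟩ := Finset.mem_image.1 (Finset.mem_coe.1 hy)
      exact hsep p p.2 p' p'.2 fun h => hxy (by simp [h])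
  calc ∑ p ∈ F, ENNReal.ofReal (logGauge s (p : ℝ × ℝ).2)
      ≤ ∑ p ∈ F, ENNReal.ofReal ((q * Real.log 2) ^ (-s)) :=
        Finset.sum_le_sum fun p _ => ENNReal.ofReal_le_ofReal (logGauge_le hs hq (hQ p p.2).2)
    _ = (F.card : ℝ≥0∞) * ENNReal.ofReal ((q * Real.log 2) ^ (-s)) := by
        rw [Finset.sum_const, nsmul_eq_mul]
    _ ≤ _ := by
        rw [ENNReal.ofReal_mul (by positivity)]
        gcongr
        rw [← ENNReal.ofReal_natCast]
        exact ENNReal.ofReal_le_ofReal (by exact_mod_cast hcard)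

theorem summable_mul_rpow_neg {s c : ℝ} (hs : 2 < s) (C : ℝ) (hc : 0 < c) :
    Summable (fun q : ℕ => C * (q : ℝ) * (q * c) ^ (-s)) := by
  have h1 : Summable (fun q : ℕ => (q : ℝ) ^ (-(s - 1))) :=
    Real.summable_nat_rpow.2 (by linarith)
  refine (summable_congr fun q => ?_).1 (h1.mul_left (C * c ^ (-s)))
  rcases Nat.eq_zero_or_pos q with rfl | hq
  · rw [Nat.cast_zero, Real.zero_rpow (by linarith)]
    simp
  · have hq' : (0 : ℝ) < q := by exact_mod_cast hq
    rw [Real.mul_rpow hq'.le hc.le, neg_sub, sub_eq_add_neg 1 s, Real.rpow_add hq', Real.rpow_one]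
    ring

/-- A packing may use all dyadic generations of radii at once, so the costs `q ^ (1 - s)` must be
summed over `q`. This is why the threshold is `2` here and `1` for Hausdorff measure. -/
theorem IsLogSparse.packingPreMeasure_eq_zero {E : Set ℝ} (h : IsLogSparse E) {s : ℝ}
    (hs : 2 < s) : packingPreMeasure (logGauge s) E = 0 := by
  obtain ⟨C, hC⟩ := h
  have h2 : 0 < Real.log 2 := Real.log_pos one_lt_two
  set u : ℕ → ℝ≥0∞ := fun q => ENNReal.ofReal (C * q * (q * Real.log 2) ^ (-s)) with hu
  have hsum : ∑' q, u q ≠ ∞ :=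
    (summable_mul_rpow_neg hs C h2).tsum_ofReal_ne_top
  refine le_antisymm (ge_of_tendsto (ENNReal.tendsto_sum_nat_add u hsum) ?_) bot_le
  filter_upwards [eventually_ge_atTop 1] with q₀ hq₀
  refine iInf₂_le_of_le ((1 / 2 : ℝ) ^ q₀) (by positivity) (iSup₂_le fun P hP => ?_)
  let t : ℕ → Set (ℝ × ℝ) := fun k =>
    {p ∈ P | (1 / 2 : ℝ) ^ (k + q₀ + 1) < p.2 ∧ p.2 ≤ (1 / 2) ^ (k + q₀)}
  have hcov : P ⊆ ⋃ k, t k := by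
    intro p hp
    obtain ⟨-, h0, h1⟩ := hP.1 p hp
    obtain ⟨n, hn1, hn2⟩ := exists_nat_pow_near_of_lt_one h0
      (h1.le.trans (pow_le_one₀ (by norm_num) (by norm_num))) (by norm_num : (0 : ℝ) < 1 / 2)
      (by norm_num)
    have : q₀ < n + 1 := (pow_lt_pow_iff_right_of_lt_one₀ (by norm_num : (0 : ℝ) < 1 / 2)
      (by norm_num)).1 (hn1.trans h1)
    refine mem_iUnion.2 ⟨n - q₀, hp, ?_⟩
    rw [Nat.sub_add_cancel (by omega)]
    exact ⟨hn1, hn2⟩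
  calc ∑' p : P, ENNReal.ofReal (logGauge s (p : ℝ × ℝ).2)
      ≤ ∑' p : ⋃ k, t k, ENNReal.ofReal (logGauge s (p : ℝ × ℝ).2) :=
        ENNReal.tsum_mono_subtype (fun p : ℝ × ℝ => ENNReal.ofReal (logGauge s p.2)) hcov
    _ ≤ ∑' k, ∑' p : t k, ENNReal.ofReal (logGauge s (p : ℝ × ℝ).2) :=
        ENNReal.tsum_iUnion_le_tsum (fun p : ℝ × ℝ => ENNReal.ofReal (logGauge s p.2)) t
    _ ≤ ∑' k, u (k + q₀) := ENNReal.tsum_le_tsum fun k =>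
        tsum_le_of_sparse_centres (by linarith) (by omega) (hC _ (by omega)) hP
          (sep_subset _ _) fun p hp => hp.2

theorem not_isSigmaLogSparse_of_logDim {A : Set ℝ}
    (hdim : 2 < packingLogDim A ∨ 1 < hausdorffLogDim A) : ¬ IsSigmaLogSparse A := by
  rintro ⟨e, he, hc⟩
  rcases hdim with h | h
  · obtain ⟨s, hs, hs'⟩ := ENNReal.lt_iff_exists_nnreal_btwn.1 h
    have hs2 : (2 : ℝ) < s := by exact_mod_cast hs
    refine hs'.not_ge (iInf₂_le_of_le (s : ℝ) (by linarith) (iInf_le_of_le ?_ (by simp)))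
    refine le_antisymm (iInf₂_le_of_le e hc ?_) bot_le
    simp [fun i => (he i).packingPreMeasure_eq_zero hs2]
  · obtain ⟨s, hs, hs'⟩ := ENNReal.lt_iff_exists_nnreal_btwn.1 h
    have hs1 : (1 : ℝ) < s := by exact_mod_cast hs
    refine hs'.not_ge (iInf₂_le_of_le (s : ℝ) (by linarith) (iInf_le_of_le ?_ (by simp)))
    exact measure_mono_null hc (measure_iUnion_null fun i => (he i).gaugeHausdorff_eq_zero hs1)

/-! ### Hitting sets -/

/-- Double counting: some element does at least as well as the average one. -/
theorem exists_mem_many {α : Type*} [DecidableEq α] (U : Finset α) (𝒯 : Finset (Finset α))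
    {n : ℝ} (hU : U.Nonempty) (h : ∀ T ∈ 𝒯, T ⊆ U ∧ n ≤ T.card) :
    ∃ u ∈ U, n / U.card * 𝒯.card ≤ ({T ∈ 𝒯 | u ∈ T}.card : ℝ) := by
  by_contra! hcon
  have hU' : (0 : ℝ) < U.card := by exact_mod_cast hU.card_pos
  have h1 : ∑ u ∈ U, ({T ∈ 𝒯 | u ∈ T}.card : ℝ) < n * 𝒯.card := by
    calc _ < ∑ _u ∈ U, n / U.card * 𝒯.card := Finset.sum_lt_sum_of_nonempty hU hcon
      _ = _ := by
        rw [Finset.sum_const, nsmul_eq_mul]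
        field_simp
  have h2 : ∑ u ∈ U, ({T ∈ 𝒯 | u ∈ T}.card : ℝ) = ∑ T ∈ 𝒯, (T.card : ℝ) := by
    have := Finset.sum_card_bipartiteAbove_eq_sum_card_bipartiteBelow
      (s := U) (t := 𝒯) (fun u T => u ∈ T)
    simp only [Finset.bipartiteAbove, Finset.bipartiteBelow] at this
    rw [← Nat.cast_sum, this, Nat.cast_sum]
    refine Finset.sum_congr rfl fun T hT => ?_
    rw [Finset.filter_mem_eq_inter, Finset.inter_eq_right.2 (h T hT).1]
  rw [h2] at h1
  have h3 : n * 𝒯.card ≤ ∑ T ∈ 𝒯, (T.card : ℝ) := by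
    rw [mul_comm, ← nsmul_eq_mul]
    exact Finset.card_nsmul_le_sum _ _ _ fun T hT => (h T hT).2
  linarith

/-- Greedy choice: each new element hits a proportion at least `n / |U|` of the sets still missed.
-/
theorem exists_partial_hitting_set {α : Type*} [DecidableEq α] (U : Finset α)
    (𝒯 : Finset (Finset α)) {n : ℝ} (hU : U.Nonempty) (hn : n ≤ U.card)
    (h : ∀ T ∈ 𝒯, T ⊆ U ∧ n ≤ T.card) (k : ℕ) :
    ∃ V : Finset α, V.card ≤ k ∧
      ({T ∈ 𝒯 | Disjoint T V}.card : ℝ) ≤ (1 - n / U.card) ^ k * 𝒯.card := by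
  have hU' : (0 : ℝ) < U.card := by exact_mod_cast hU.card_pos
  induction k with
  | zero => exact ⟨∅, by simp⟩
  | succ k ih =>
    obtain ⟨V, hV, hVc⟩ := ih
    obtain ⟨u, -, hu⟩ := exists_mem_many U {T ∈ 𝒯 | Disjoint T V} hU
      fun T hT => h T (Finset.mem_filter.1 hT).1
    refine ⟨insert u V, (Finset.card_insert_le u V).trans (by omega), ?_⟩
    have hsub : {T ∈ 𝒯 | Disjoint T (insert u V)} =
        {T ∈ {T ∈ 𝒯 | Disjoint T V} | u ∉ T} := by
      ext T
      simp only [Finset.mem_filter, Finset.disjoint_insert_right]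
      tauto
    have hadd := Finset.card_filter_add_card_filter_not
      (s := {T ∈ 𝒯 | Disjoint T V}) (fun T => u ∈ T)
    have hadd' : (({T ∈ {T ∈ 𝒯 | Disjoint T V} | u ∈ T}.card : ℕ) : ℝ) +
        ({T ∈ {T ∈ 𝒯 | Disjoint T V} | u ∉ T}.card : ℕ) =
        ({T ∈ 𝒯 | Disjoint T V}.card : ℕ) := by exact_mod_cast hadd
    have h1 : 0 ≤ 1 - n / U.card := by
      rw [sub_nonneg, div_le_one hU']
      exact hn
    rw [hsub]
    calc (({T ∈ {T ∈ 𝒯 | Disjoint T V} | u ∉ T}.card : ℕ) : ℝ)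
        ≤ (1 - n / U.card) * {T ∈ 𝒯 | Disjoint T V}.card := by linarith
      _ ≤ (1 - n / U.card) * ((1 - n / U.card) ^ k * 𝒯.card) := by gcongr
      _ = _ := by ring

/-- A family of subsets of `U` with at least `n` elements each has a hitting set with about
`(|U| / n) log |𝒯|` elements. -/
theorem exists_hitting_set {α : Type*} [DecidableEq α] (U : Finset α)
    (𝒯 : Finset (Finset α)) {n : ℝ} (hn0 : 0 < n)
    (h : ∀ T ∈ 𝒯, T ⊆ U ∧ n ≤ T.card) :
    ∃ V : Finset α, (V.card : ℝ) ≤ U.card * Real.log 𝒯.card / n + 1 ∧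
      ∀ T ∈ 𝒯, ∃ v ∈ V, v ∈ T := by
  rcases 𝒯.eq_empty_or_nonempty with rfl | ⟨T₀, hT₀⟩
  · exact ⟨∅, by simp⟩
  have hnU : n ≤ U.card := (h T₀ hT₀).2.trans (by exact_mod_cast Finset.card_le_card (h T₀ hT₀).1)
  have hU' : (0 : ℝ) < U.card := hn0.trans_le hnU
  have hU : U.Nonempty := Finset.card_pos.1 (by exact_mod_cast hU')
  have h𝒯 : (1 : ℝ) ≤ 𝒯.card := by exact_mod_cast Finset.card_pos.2 ⟨T₀, hT₀⟩
  set x : ℝ := U.card * Real.log 𝒯.card / n with hx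
  have hx0 : 0 ≤ x := by
    have := Real.log_nonneg h𝒯
    positivity
  obtain ⟨V, hV, hVc⟩ := exists_partial_hitting_set U 𝒯 hU hnU h (⌊x⌋₊ + 1)
  -- By `1 - y ≤ exp (-y)`, more than `x` greedy steps leave fewer than one set unhit.
  have hlt : (1 - n / U.card) ^ (⌊x⌋₊ + 1) * 𝒯.card < 1 := by
    calc (1 - n / U.card) ^ (⌊x⌋₊ + 1) * 𝒯.card
        ≤ Real.exp (-(n / U.card)) ^ (⌊x⌋₊ + 1) * 𝒯.card := by
          gcongr
          · rw [sub_nonneg, div_le_one hU']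
            exact hnU
          · exact Real.one_sub_le_exp_neg _
      _ = Real.exp (-(n / U.card) * (⌊x⌋₊ + 1)) * Real.exp (Real.log 𝒯.card) := by
          rw [Real.exp_log (by linarith), ← Real.exp_nat_mul]
          push_cast
          ring_nf
      _ < 1 := by
          rw [← Real.exp_add, Real.exp_lt_one_iff]
          have h1 : n / U.card * x = Real.log 𝒯.card := by
            rw [hx]
            field_simp
          have h2 : n / U.card * x < n / U.card * (⌊x⌋₊ + 1) :=
            mul_lt_mul_of_pos_left (Nat.lt_floor_add_one x) (by positivity)
          linarith
  have hzero : {T ∈ 𝒯 | Disjoint T V}.card = 0 := by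
    have : ({T ∈ 𝒯 | Disjoint T V}.card : ℝ) < 1 := hVc.trans_lt hlt
    exact_mod_cast Nat.lt_one_iff.1 (by exact_mod_cast this)
  refine ⟨V, ?_, fun T hT => ?_⟩
  · calc (V.card : ℝ) ≤ ((⌊x⌋₊ + 1 : ℕ) : ℝ) := by exact_mod_cast hV
      _ ≤ x + 1 := by
        push_cast
        linarith [Nat.floor_le hx0]
  · by_contra! hcon
    rw [Finset.card_eq_zero] at hzero
    have : T ∈ {T ∈ 𝒯 | Disjoint T V} :=
      Finset.mem_filter.2 ⟨hT, Finset.disjoint_right.2 hcon⟩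
    rw [hzero] at this
    simp at this

/-! ### Values of a polynomial on a separated set -/

/-- Lagrange interpolation of `p - y` at the `d + 1` nodes of `T`: each term is a value of size at
most `η` over a product of `d` differences of size at least `δ`. -/
theorem abs_leadingCoeff_le {p : ℝ[X]} {T : Finset ℝ} {δ η y : ℝ} (hd : 0 < p.natDegree)
    (hT : T.card = p.natDegree + 1) (hδ : 0 < δ)
    (hsep : (T : Set ℝ).Pairwise fun x x' => δ ≤ |x - x'|) (hη : ∀ x ∈ T, |p.eval x - y| ≤ η) :
    |p.leadingCoeff| ≤ (p.natDegree + 1) * (η / δ ^ p.natDegree) := by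
  classical
  have hdeg : p.degree ≠ ⊥ := fun h => by
    rw [Polynomial.degree_eq_bot] at h
    simp [h] at hd
  have hC : (p - C y).leadingCoeff = p.leadingCoeff :=
    leadingCoeff_sub_of_degree_lt
      (degree_C_le.trans_lt (natDegree_pos_iff_degree_pos.1 hd))
  have hCd : (p - C y).degree = p.natDegree := by
    rw [degree_sub_C (natDegree_pos_iff_degree_pos.1 hd), degree_eq_natDegree]
    exact fun h => by simp [h] at hd
  have hsum := Lagrange.leadingCoeff_eq_sum (s := T) (v := id) (P := p - C y)
    (Function.injective_id.injOn) (by rw [hCd, hT]; norm_cast)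
  rw [hC] at hsum
  rw [hsum]
  refine (Finset.abs_sum_le_sum_abs _ _).trans ?_
  calc _ ≤ ∑ _i ∈ T, η / δ ^ p.natDegree := Finset.sum_le_sum fun i hi => ?_
    _ = _ := by
      rw [Finset.sum_const, hT, nsmul_eq_mul]
      push_cast
      ring
  rw [abs_div, eval_sub, eval_C, Finset.abs_prod]
  have h0 : 0 ≤ η := (abs_nonneg _).trans (hη i hi)
  refine div_le_div₀ h0 (hη i hi) (by positivity) ?_
  have hcard : (T.erase i).card = p.natDegree := by
    rw [Finset.card_erase_of_mem hi, hT]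
    omega
  rw [← hcard, ← Finset.prod_const]
  refine Finset.prod_le_prod (fun _ _ => hδ.le) fun j hj => ?_
  rw [Finset.mem_erase] at hj
  exact hsep hi hj.2 hj.1.symm

/-- The polynomials of degree `d` with coefficients bounded by `m` and leading coefficient at least
`1 / m` in absolute value. -/
def boundedPolys (d m : ℕ) : Set ℝ[X] :=
  {p | p.natDegree = d ∧ (∀ i, |p.coeff i| ≤ m) ∧ 1 ≤ m * |p.leadingCoeff|}

theorem eval_eq_sum_fin {d : ℕ} {p : ℝ[X]} (hp : p.natDegree = d) (x : ℝ) :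
    p.eval x = ∑ i : Fin (d + 1), p.coeff i * x ^ (i : ℕ) := by
  rw [eval_eq_sum_range, hp, Finset.sum_range]

/-- The value at `a` of the integer polynomial with coefficients `z`, rounded to the grid of
width `d + 1`. -/
noncomputable def gridCell {d : ℕ} (z : Fin (d + 1) → ℤ) (a : ℝ) : ℤ :=
  ⌊(∑ i, (z i : ℝ) * a ^ (i : ℕ)) / (d + 1)⌋

theorem gridCell_mem {d : ℕ} {z : Fin (d + 1) → ℤ} {Z : ℕ} (hz : ∀ i, z i ∈ Finset.Icc (-(Z : ℤ)) Z)
    {a : ℝ} (ha : a ∈ Icc (0 : ℝ) 1) : gridCell z a ∈ Finset.Icc (-(Z : ℤ)) Z := by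
  have habs : |∑ i, (z i : ℝ) * a ^ (i : ℕ)| ≤ (d + 1) * Z := by
    refine (Finset.abs_sum_le_sum_abs _ _).trans ?_
    calc _ ≤ ∑ _i : Fin (d + 1), (Z : ℝ) := Finset.sum_le_sum fun i _ => ?_
      _ = _ := by simp
    have hzi := Finset.mem_Icc.1 (hz i)
    have hzi' : |(z i : ℝ)| ≤ Z := by
      rw [abs_le]
      exact ⟨by exact_mod_cast hzi.1, by exact_mod_cast hzi.2⟩
    rw [abs_mul, abs_pow, abs_of_nonneg ha.1]
    calc |(z i : ℝ)| * a ^ (i : ℕ) ≤ Z * 1 :=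
          mul_le_mul hzi' (pow_le_one₀ ha.1 ha.2) (pow_nonneg ha.1 _) (by positivity)
      _ = Z := mul_one _
  have hd : (0 : ℝ) < d + 1 := by positivity
  rw [abs_le] at habs
  rw [Finset.mem_Icc, gridCell, Int.le_floor]
  constructor
  · rw [le_div_iff₀ hd]
    push_cast
    linarith
  · refine Int.cast_le (R := ℝ) |>.1 ((Int.floor_le _).trans ?_)
    rw [div_le_iff₀ hd]
    push_cast
    linarith

/-- Rounding the coefficients down to multiples of `ρ` and then the value down to the grid each
costs at most `(d + 1) * ρ`. Both errors are nonnegative because `a ≥ 0`. -/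
theorem eval_sub_gridCell_mem_Icc {d : ℕ} {p : ℝ[X]} (hp : p.natDegree = d) {ρ : ℝ} (hρ : 0 < ρ)
    {a : ℝ} (ha : a ∈ Icc (0 : ℝ) 1) :
    p.eval a - ((d + 1) * ρ) * gridCell (fun i : Fin (d + 1) => ⌊p.coeff i / ρ⌋) a ∈
      Icc 0 (2 * ((d + 1) * ρ)) := by
  set z : Fin (d + 1) → ℤ := fun i => ⌊p.coeff i / ρ⌋ with hz
  have hd : (0 : ℝ) < d + 1 := by positivity
  have hfl : ∀ i, 0 ≤ p.coeff (i : Fin (d + 1)) - ρ * z i ∧ p.coeff i - ρ * z i ≤ ρ := by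
    intro i
    have h1 := Int.floor_le (p.coeff i / ρ)
    have h2 := (Int.lt_floor_add_one (p.coeff i / ρ)).le
    rw [le_div_iff₀ hρ] at h1
    rw [div_le_iff₀ hρ] at h2
    constructor <;> simp only [hz] <;> linarith
  have hdiff : p.eval a - ρ * ∑ i, (z i : ℝ) * a ^ (i : ℕ) ∈ Icc 0 ((d + 1) * ρ) := by
    rw [eval_eq_sum_fin hp, Finset.mul_sum, ← Finset.sum_sub_distrib]
    have hi : ∀ i : Fin (d + 1), p.coeff i * a ^ (i : ℕ) - ρ * (z i * a ^ (i : ℕ)) =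
        (p.coeff i - ρ * z i) * a ^ (i : ℕ) := fun i => by ring
    simp_rw [hi]
    constructor
    · exact Finset.sum_nonneg fun i _ => mul_nonneg (hfl i).1 (pow_nonneg ha.1 _)
    · calc _ ≤ ∑ _i : Fin (d + 1), ρ * 1 := Finset.sum_le_sum fun i _ =>
            mul_le_mul (hfl i).2 (pow_le_one₀ ha.1 ha.2) (pow_nonneg ha.1 _) hρ.le
        _ = _ := by simp
  have h1 := Int.floor_le ((∑ i, (z i : ℝ) * a ^ (i : ℕ)) / (d + 1))
  have h2 := (Int.lt_floor_add_one ((∑ i, (z i : ℝ) * a ^ (i : ℕ)) / (d + 1))).le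
  rw [le_div_iff₀ hd] at h1
  rw [div_le_iff₀ hd] at h2
  have h1' := mul_le_mul_of_nonneg_left h1 hρ.le
  have h2' := mul_le_mul_of_nonneg_left h2 hρ.le
  change _ - _ * ((⌊(∑ i, (z i : ℝ) * a ^ (i : ℕ)) / (d + 1)⌋ : ℤ) : ℝ) ∈ _
  constructor <;> nlinarith [hdiff.1, hdiff.2]

/-- With `d + 1` points in one cell, `abs_leadingCoeff_le` would force the leading coefficient below
`1 / m`; hence each fibre has at most `d` points. -/
theorem card_le_mul_card_image_gridCell {d m : ℕ} (hd : 0 < d) {p : ℝ[X]}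
    (hp : p ∈ boundedPolys d m) {δ ρ : ℝ} (hδ : 0 < δ) (hρ : 0 < ρ)
    (hδρ : m * (d + 1) * (2 * ((d + 1) * ρ)) < δ ^ d) {S : Finset ℝ}
    (hS : (S : Set ℝ) ⊆ Icc 0 1) (hsep : (S : Set ℝ).Pairwise fun x y => δ ≤ |x - y|) :
    S.card ≤ d * (S.image (gridCell fun i : Fin (d + 1) => ⌊p.coeff i / ρ⌋)).card := by
  refine Finset.card_le_mul_card_image S d fun j _ => ?_
  by_contra! hcon
  obtain ⟨T, hTS, hT⟩ := Finset.exists_subset_card_eq (Nat.succ_le_of_lt hcon)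
  obtain ⟨hpd, -, hlead⟩ := hp
  have hTS' : T ⊆ S := hTS.trans (Finset.filter_subset _ _)
  have hle := abs_leadingCoeff_le (p := p) (T := T) (δ := δ) (η := 2 * ((d + 1) * ρ))
    (y := (d + 1) * ρ * j) (by omega) (by rw [hT, hpd]) hδ
    (hsep.mono (Finset.coe_subset.2 hTS')) fun x hx => by
      have hmem := eval_sub_gridCell_mem_Icc hpd hρ (hS (hTS' hx))
      rw [(Finset.mem_filter.1 (hTS hx)).2] at hmem
      rw [abs_of_nonneg hmem.1]
      exact hmem.2
  rw [hpd] at hle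
  have h1 : (m : ℝ) * |p.leadingCoeff| ≤ m * (d + 1) * (2 * ((d + 1) * ρ)) / δ ^ d := by
    calc (m : ℝ) * |p.leadingCoeff| ≤ m * ((d + 1) * (2 * ((d + 1) * ρ) / δ ^ d)) := by gcongr
      _ = _ := by ring
  have h2 : (m : ℝ) * (d + 1) * (2 * ((d + 1) * ρ)) / δ ^ d < 1 := by
    rwa [div_lt_one (by positivity)]
  linarith

/-- The cells hit by the values of a polynomial have a hitting set whose cardinality is
logarithmic in the number of polynomials to be tested. -/
theorem exists_cells {d m : ℕ} (hd : 0 < d) {δ ρ : ℝ} (hδ : 0 < δ) (hρ : 0 < ρ)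
    (hδρ : m * (d + 1) * (2 * ((d + 1) * ρ)) < δ ^ d) {S : Finset ℝ} (hSne : S.Nonempty)
    (hS : (S : Set ℝ) ⊆ Icc 0 1) (hsep : (S : Set ℝ).Pairwise fun x y => δ ≤ |x - y|) {Z : ℕ}
    (hZ : m / ρ + 1 ≤ Z) :
    ∃ V : Finset ℤ,
      (V.card : ℝ) ≤ (2 * Z + 1) * ((d + 1) * Real.log (2 * Z + 1)) / (S.card / d) + 1 ∧
      ∀ p ∈ boundedPolys d m, ∃ a ∈ S, ∃ v ∈ V,
        p.eval a ∈ Icc (((d + 1) * ρ) * v) (((d + 1) * ρ) * v + 2 * ((d + 1) * ρ)) := by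
  have hd' : (0 : ℝ) < d := by exact_mod_cast hd
  have hS0 : (0 : ℝ) < S.card := by exact_mod_cast hSne.card_pos
  set U : Finset ℤ := Finset.Icc (-(Z : ℤ)) Z with hU
  have hUc : U.card = 2 * Z + 1 := by
    rw [hU, Int.card_Icc]
    omega
  set Q : Finset (Fin (d + 1) → ℤ) := Fintype.piFinset fun _ => U with hQ
  have hQc : Q.card = (2 * Z + 1) ^ (d + 1) := by
    rw [hQ, Fintype.card_piFinset, Finset.prod_const, hUc]
    simp
  -- Small images are discarded; those arising from `boundedPolys d m` survive by
  -- `card_le_mul_card_image_gridCell`.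
  set 𝒯 : Finset (Finset ℤ) :=
    {T ∈ Q.image fun z => S.image (gridCell z) | (S.card : ℝ) / d ≤ T.card} with h𝒯
  have h𝒯c : 𝒯.card ≤ (2 * Z + 1) ^ (d + 1) :=
    (Finset.card_filter_le _ _).trans (Finset.card_image_le.trans hQc.le)
  obtain ⟨V, hVc, hV⟩ := exists_hitting_set U 𝒯 (n := (S.card : ℝ) / d) (by positivity)
    fun T hT => by
      obtain ⟨hT1, hT2⟩ := Finset.mem_filter.1 hT
      refine ⟨?_, hT2⟩
      obtain ⟨z, hz, rfl⟩ := Finset.mem_image.1 hT1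
      refine Finset.image_subset_iff.2 fun a ha => ?_
      exact gridCell_mem (Fintype.mem_piFinset.1 hz) (hS ha)
  refine ⟨V, hVc.trans ?_, fun p hp => ?_⟩
  · have hlog : Real.log 𝒯.card ≤ (d + 1) * Real.log (2 * Z + 1) := by
      rcases Nat.eq_zero_or_pos 𝒯.card with h0 | h0
      · rw [h0, Nat.cast_zero, Real.log_zero]
        have : 0 ≤ Real.log (2 * Z + 1) := Real.log_nonneg (by linarith [Z.cast_nonneg (α := ℝ)])
        positivity
      · calc Real.log 𝒯.card ≤ Real.log ((2 * Z + 1) ^ (d + 1)) :=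
              Real.log_le_log (by exact_mod_cast h0) (by exact_mod_cast h𝒯c)
          _ = _ := by
            rw [Real.log_pow]
            push_cast
            ring
    rw [hUc]
    push_cast
    gcongr
  · set z : Fin (d + 1) → ℤ := fun i => ⌊p.coeff i / ρ⌋ with hz
    have hzU : ∀ i, z i ∈ U := by
      intro i
      have hi := abs_le.1 (hp.2.1 i)
      have h1 : p.coeff i / ρ ≤ m / ρ := by
        gcongr
        exact hi.2
      have h2 : -(m / ρ) ≤ p.coeff i / ρ := by
        rw [← neg_div]
        gcongr
        exact hi.1
      rw [hU, Finset.mem_Icc, hz]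
      constructor
      · rw [Int.le_floor]
        push_cast
        linarith
      · refine Int.cast_le (R := ℝ) |>.1 ((Int.floor_le _).trans ?_)
        push_cast
        linarith
    have hmem : S.image (gridCell z) ∈ 𝒯 := by
      refine Finset.mem_filter.2 ⟨Finset.mem_image.2 ⟨z, Fintype.mem_piFinset.2 hzU, rfl⟩, ?_⟩
      rw [div_le_iff₀' hd']
      exact_mod_cast card_le_mul_card_image_gridCell hd hp hδ hρ hδρ hS hsep
    obtain ⟨v, hv, hvT⟩ := hV _ hmem
    obtain ⟨a, ha, rfl⟩ := Finset.mem_image.1 hvT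
    have := eval_sub_gridCell_mem_Icc hp.1 hρ (hS ha)
    exact ⟨a, ha, _, hv, by linarith [this.1], by linarith [this.2]⟩

theorem boundedPolys_zero (d : ℕ) : boundedPolys d 0 = ∅ := by
  ext p
  simp only [boundedPolys, mem_ofPred_eq, mem_empty_iff_false, iff_false]
  rintro ⟨-, -, h⟩
  norm_num at h

/-- A set that is not log-sparse has a finite subset which every polynomial of a bounded family
maps somewhere well inside a given closed set of small measure. -/
theorem exists_finset_closed_of_not_isLogSparse {E : Set ℝ} (hE : E ⊆ Icc 0 1)
    (hsp : ¬ IsLogSparse E) {d : ℕ} (hd : 0 < d) (m : ℕ) {ε : ℝ} (hε : 0 < ε) :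
    ∃ S : Finset ℝ, (S : Set ℝ) ⊆ E ∧ ∃ V : Set ℝ, IsClosed V ∧ volume V ≤ ENNReal.ofReal ε ∧
      ∃ r > 0, ∀ p ∈ boundedPolys d m, ∃ a ∈ S, Metric.closedBall (p.eval a) r ⊆ V := by
  rcases Nat.eq_zero_or_pos m with rfl | hm
  · exact ⟨∅, by simp, ∅, isClosed_empty, by simp, 1, one_pos, by simp [boundedPolys_zero]⟩
  have hm' : (1 : ℝ) ≤ m := by exact_mod_cast hm
  have hd' : (1 : ℝ) ≤ d := by exact_mod_cast hd
  -- The cell width will be `κ * δ ^ d`. The third bound keeps fibres small; the fourth pays for the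
  -- additive `1` in the size of the hitting set.
  obtain ⟨κ, hκ0, hκ1, hκm, hκε⟩ : ∃ κ : ℝ, 0 < κ ∧ κ ≤ 1 ∧
      m * (d + 1) * (2 * κ) < 1 ∧ 4 * κ ≤ ε / 2 := by
    refine ⟨min 1 (min (1 / (4 * (m * (d + 1)))) (ε / 8)), by positivity, min_le_left _ _, ?_, ?_⟩
    · have h : min 1 (min (1 / (4 * ((m : ℝ) * (d + 1)))) (ε / 8)) ≤ 1 / (4 * ((m : ℝ) * (d + 1))) :=
        (min_le_right _ _).trans (min_le_left _ _)
      calc _ ≤ (m : ℝ) * (d + 1) * (2 * (1 / (4 * (m * (d + 1))))) := by gcongr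
        _ = 1 / 2 := by field_simp; norm_num
        _ < 1 := by norm_num
    · have h : min 1 (min (1 / (4 * ((m : ℝ) * (d + 1)))) (ε / 8)) ≤ ε / 8 :=
        (min_le_right _ _).trans (min_le_right _ _)
      linarith
  set C₀ : ℝ := (d + 1) * (2 * m + 5) with hC₀
  set C₁ : ℝ := C₀ / κ with hC₁
  have hC₀0 : 0 < C₀ := by positivity
  have hC₁0 : 0 < C₁ := by positivity
  set K : ℝ := 4 * (C₀ * ((d + 1) * (C₁ + d))) * d with hK
  have hK0 : 0 < K := by positivity
  obtain ⟨N, hN⟩ := exists_nat_ge (K / (ε / 2))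
  simp only [IsLogSparse, not_exists, not_forall, not_le] at hsp
  obtain ⟨q, hq, S, hSE, hsep, hcard⟩ := hsp N
  have hq' : (1 : ℝ) ≤ q := by exact_mod_cast hq
  have hN0 : (0 : ℝ) < N := lt_of_lt_of_le (by positivity) hN
  have hScard : (N : ℝ) * q ≤ S.card := by exact_mod_cast hcard.le
  set δ : ℝ := (1 / 2) ^ q with hδ
  have hδ0 : 0 < δ := by positivity
  set W : ℝ := κ * δ ^ d with hW
  have hW0 : 0 < W := by positivity
  have hδd : δ ^ d ≤ 1 := pow_le_one₀ hδ0.le (pow_le_one₀ (by norm_num) (by norm_num))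
  have hWκ : W ≤ κ := mul_le_of_le_one_right hκ0.le hδd
  set ρ : ℝ := W / (d + 1) with hρ
  have hρ0 : 0 < ρ := by positivity
  have hρW : (d + 1) * ρ = W := by
    rw [hρ]
    field_simp
  have hρ1 : ρ ≤ 1 := (div_le_self hW0.le (by linarith)).trans (hWκ.trans hκ1)
  have hδρ : m * (d + 1) * (2 * ((d + 1) * ρ)) < δ ^ d := by
    rw [hρW, hW]
    calc (m : ℝ) * (d + 1) * (2 * (κ * δ ^ d)) = m * (d + 1) * (2 * κ) * δ ^ d := by ring
      _ < 1 * δ ^ d := by gcongr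
      _ = δ ^ d := one_mul _
  obtain ⟨V₀, hV₀c, hV₀⟩ := exists_cells hd hδ0 hρ0 hδρ (S := S)
    (Finset.card_pos.1 (by omega)) (hSE.trans hE) hsep (Z := ⌈(m : ℝ) / ρ⌉₊ + 1)
    (by push_cast; linarith [Nat.le_ceil ((m : ℝ) / ρ)])
  set Z : ℕ := ⌈(m : ℝ) / ρ⌉₊ + 1 with hZ
  have hZle : ρ * (2 * (Z : ℝ) + 1) ≤ 2 * m + 5 := by
    have h1 : (Z : ℝ) ≤ m / ρ + 2 := by
      rw [hZ]
      push_cast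
      linarith [Nat.ceil_lt_add_one (a := (m : ℝ) / ρ) (by positivity)]
    calc ρ * (2 * (Z : ℝ) + 1) ≤ ρ * (2 * (m / ρ + 2) + 1) := by gcongr
      _ = 2 * m + 5 * ρ := by field_simp; ring
      _ ≤ 2 * m + 5 := by linarith
  have hWZ : W * (2 * (Z : ℝ) + 1) ≤ C₀ := by
    rw [← hρW, hC₀, mul_assoc]
    gcongr
  -- The logarithm is linear in `q`, and this factor cancels against `|S| ≥ N q`.
  have hlog : Real.log (2 * Z + 1) ≤ (C₁ + d) * q := by
    have h1 : (2 * Z + 1 : ℝ) ≤ C₁ * 2 ^ (q * d) := by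
      have h2 : C₁ * 2 ^ (q * d) = C₀ / W := by
        rw [hC₁, hW, hδ, ← pow_mul, one_div, inv_pow]
        field_simp
      rw [h2, le_div_iff₀ hW0]
      linarith
    calc Real.log (2 * Z + 1) ≤ Real.log (C₁ * 2 ^ (q * d)) :=
          Real.log_le_log (by positivity) h1
      _ = Real.log C₁ + q * d * Real.log 2 := by
          rw [Real.log_mul hC₁0.ne' (by positivity), Real.log_pow]
          push_cast
          ring
      _ ≤ C₁ * q + q * d * 1 := by
          gcongr
          · calc Real.log C₁ ≤ C₁ := (Real.log_le_sub_one_of_pos hC₁0).trans (by linarith)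
              _ ≤ C₁ * q := le_mul_of_one_le_right hC₁0.le hq'
          · linarith [Real.log_two_lt_d9]
      _ = _ := by ring
  -- The value lies within `W` of the centre `W * v + W`; the doubled radius leaves room for a ball
  -- of radius `W` around it.
  refine ⟨S, hSE, ⋃ v ∈ V₀, Metric.closedBall (W * v + W) (2 * W),
    V₀.finite_toSet.isClosed_biUnion fun _ _ => Metric.isClosed_closedBall, ?_, W, hW0,
    fun p hp => ?_⟩
  · calc volume (⋃ v ∈ V₀, Metric.closedBall (W * v + W) (2 * W))
        ≤ ∑ v ∈ V₀, volume (Metric.closedBall (W * (v : ℝ) + W) (2 * W)) :=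
          measure_biUnion_finset_le _ _
      _ = ENNReal.ofReal (V₀.card * (4 * W)) := by
          simp_rw [Real.volume_closedBall]
          rw [Finset.sum_const, nsmul_eq_mul, ENNReal.ofReal_mul (p := (V₀.card : ℝ))
            (by positivity), ENNReal.ofReal_natCast]
          congr 2
          ring
      _ ≤ ENNReal.ofReal ε := ENNReal.ofReal_le_ofReal ?_
    have hlog0 : 0 ≤ Real.log (2 * Z + 1) :=
      Real.log_nonneg (by linarith [Z.cast_nonneg (α := ℝ)])
    calc (V₀.card : ℝ) * (4 * W)
        ≤ ((2 * Z + 1) * ((d + 1) * Real.log (2 * Z + 1)) / (S.card / d) + 1) * (4 * W) := by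
          gcongr
      _ = 4 * ((W * (2 * Z + 1)) * ((d + 1) * Real.log (2 * Z + 1))) * d / S.card + 4 * W := by
          rw [div_div_eq_mul_div]
          ring
      _ ≤ 4 * (C₀ * ((d + 1) * ((C₁ + d) * q))) * d / (N * q) + 4 * κ := by gcongr
      _ = K / N + 4 * κ := by
          rw [hK]
          field_simp
      _ ≤ ε / 2 + ε / 2 := by
          refine add_le_add ?_ hκε
          rw [div_le_iff₀ hN0, mul_comm]
          rwa [div_le_iff₀ (by positivity)] at hN
      _ = ε := by ring
  · obtain ⟨a, ha, v, hv, hav⟩ := hV₀ p hp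
    rw [hρW] at hav
    refine ⟨a, ha, fun y hy => mem_iUnion₂.2 ⟨v, hv, ?_⟩⟩
    rw [Real.closedBall_eq_Icc] at hy ⊢
    exact ⟨by linarith [hy.1, hav.1], by linarith [hy.2, hav.2]⟩

theorem abs_eval_sub_eval_le {d m : ℕ} {p : ℝ[X]} (hp : p ∈ boundedPolys d m) {a b : ℝ}
    (ha : a ∈ Icc (0 : ℝ) 1) (hb : b ∈ Icc (0 : ℝ) 1) :
    |p.eval a - p.eval b| ≤ (d + 1) * (m * d) * |a - b| := by
  rw [eval_eq_sum_fin hp.1, eval_eq_sum_fin hp.1, ← Finset.sum_sub_distrib]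
  refine (Finset.abs_sum_le_sum_abs _ _).trans ?_
  calc _ ≤ ∑ _i : Fin (d + 1), m * (d * |a - b|) := Finset.sum_le_sum fun i _ => ?_
    _ = _ := by
      simp
      ring
  rw [← mul_sub, abs_mul]
  refine mul_le_mul (hp.2.1 i) ?_ (abs_nonneg _) (by positivity)
  have hid : ((i : ℕ) : ℝ) ≤ d := by exact_mod_cast Nat.lt_succ_iff.1 i.2
  have hmax : max |a| |b| ^ ((i : ℕ) - 1) ≤ 1 := by
    refine pow_le_one₀ (le_max_of_le_left (abs_nonneg _)) (max_le ?_ ?_)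
    · rw [abs_of_nonneg ha.1]
      exact ha.2
    · rw [abs_of_nonneg hb.1]
      exact hb.2
  calc |a ^ (i : ℕ) - b ^ (i : ℕ)| ≤ |a - b| * i * max |a| |b| ^ ((i : ℕ) - 1) :=
        abs_pow_sub_pow_le ..
    _ ≤ |a - b| * d * 1 := by gcongr
    _ = _ := by ring

/-! ### The tree of balls over a Polish parametrisation -/

section Tree

variable {X : Type*} [MetricSpace X]

/-- The points all of whose neighbourhoods have an image that is not `σ`-log-sparse. -/
def thickPoints (g : X → ℝ) : Set X :=
  {x | ∀ U, IsOpen U → x ∈ U → ¬ IsSigmaLogSparse (g '' U)}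

/-- The complement is covered by the countably many basic open sets with `σ`-log-sparse image. -/
theorem isSigmaLogSparse_image_compl_thickPoints [SecondCountableTopology X] (g : X → ℝ) :
    IsSigmaLogSparse (g '' (thickPoints g)ᶜ) := by
  have hb := TopologicalSpace.isBasis_countableBasis X
  let I : Set (Set X) := {U ∈ TopologicalSpace.countableBasis X | IsSigmaLogSparse (g '' U)}
  have hI : I.Countable := (TopologicalSpace.countable_countableBasis X).mono (sep_subset _ _)
  refine (IsSigmaLogSparse.biUnion_countable hI (E := fun U => g '' U) fun U hU => hU.2).mono ?_
  rintro _ ⟨x, hx, rfl⟩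
  simp only [thickPoints, mem_compl_iff, mem_ofPred_eq, not_forall, not_not] at hx
  obtain ⟨U, hU, hxU, hs⟩ := hx
  obtain ⟨W, hW, hxW, hWU⟩ := hb.exists_subset_of_mem_open hxU hU
  exact mem_iUnion₂.2 ⟨W, ⟨hW, hs.mono (image_mono hWU)⟩, x, hxW, rfl⟩

/-- This lets the centres of the next level be taken thick again, so that the construction can
continue. -/
theorem not_isLogSparse_image_inter_thickPoints [SecondCountableTopology X] {g : X → ℝ} {x : X}
    (hx : x ∈ thickPoints g) {U : Set X} (hU : IsOpen U) (hxU : x ∈ U) :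
    ¬ IsLogSparse (g '' (U ∩ thickPoints g)) := by
  intro h
  refine hx U hU hxU
    ((h.isSigmaLogSparse.union (isSigmaLogSparse_image_compl_thickPoints g)).mono ?_)
  rw [← image_union]
  refine image_mono fun y hy => ?_
  by_cases hyt : y ∈ thickPoints g
  · exact Or.inl ⟨hy, hyt⟩
  · exact Or.inr hyt

/-- Lift the finite set `S` to thick points and take balls on which `g` varies so little that every
`p ∘ g` moves by at most the margin left inside `V`. -/
theorem exists_finset_balls_of_mem_thickPoints [SecondCountableTopology X] {g : X → ℝ}
    (hg : Continuous g)
    (hg01 : ∀ x, g x ∈ Icc (0 : ℝ) 1) {x : X} (hx : x ∈ thickPoints g) {r : ℝ} (hr : 0 < r)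
    {d : ℕ} (hd : 0 < d) (m : ℕ) {ε : ℝ} (hε : 0 < ε) :
    ∃ F : Finset (X × ℝ), ∃ V : Set ℝ, IsClosed V ∧ volume V ≤ ENNReal.ofReal ε ∧
      (∀ c ∈ F, c.1 ∈ thickPoints g ∧ 0 < c.2 ∧ c.2 ≤ ε) ∧
      ∀ p ∈ boundedPolys d m, ∃ c ∈ F, Metric.closedBall c.1 c.2 ⊆ Metric.closedBall x r ∧
        ∀ y ∈ Metric.closedBall c.1 c.2, p.eval (g y) ∈ V := by
  classical
  obtain ⟨S, hS, V, hV, hVε, ρ, hρ, hVp⟩ := exists_finset_closed_of_not_isLogSparse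
    (E := g '' (Metric.ball x r ∩ thickPoints g)) (by rintro _ ⟨y, -, rfl⟩; exact hg01 y)
    (not_isLogSparse_image_inter_thickPoints hx Metric.isOpen_ball (Metric.mem_ball_self hr))
    hd m hε
  -- A common Lipschitz constant on `[0, 1]` for the family; the `1` keeps it positive when `m = 0`.
  set L : ℝ := (d + 1) * (m * d) + 1 with hL
  have hL0 : 0 < L := by positivity
  have hpt : ∀ a : S, ∃ c : X × ℝ, c.1 ∈ thickPoints g ∧ 0 < c.2 ∧ c.2 ≤ ε ∧ g c.1 = a ∧
      Metric.closedBall c.1 c.2 ⊆ Metric.closedBall x r ∧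
      ∀ y ∈ Metric.closedBall c.1 c.2, |g y - g c.1| ≤ ρ / L := by
    rintro ⟨a, ha⟩
    obtain ⟨y, ⟨hyx, hyt⟩, rfl⟩ := hS ha
    obtain ⟨r₁, hr₁, hball⟩ := Metric.isOpen_iff.1 Metric.isOpen_ball y hyx
    obtain ⟨r₂, hr₂, hcont⟩ := Metric.continuous_iff.1 hg y (ρ / L) (by positivity)
    have hlt : min ε (min (r₁ / 2) (r₂ / 2)) < r₁ :=
      ((min_le_right _ _).trans (min_le_left _ _)).trans_lt (by linarith)
    have hlt' : min ε (min (r₁ / 2) (r₂ / 2)) < r₂ :=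
      ((min_le_right _ _).trans (min_le_right _ _)).trans_lt (by linarith)
    refine ⟨(y, min ε (min (r₁ / 2) (r₂ / 2))), hyt, by positivity, min_le_left _ _, rfl, ?_, ?_⟩
    · exact (Metric.closedBall_subset_ball hlt).trans (hball.trans Metric.ball_subset_closedBall)
    · intro z hz
      exact (hcont z ((Metric.mem_closedBall.1 hz).trans_lt hlt')).le
  choose c hct hc0 hcε hca hcx hcg using hpt
  refine ⟨Finset.univ.image c, V, hV, hVε, ?_, fun p hp => ?_⟩
  · intro b hb
    obtain ⟨a, -, rfl⟩ := Finset.mem_image.1 hb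
    exact ⟨hct a, hc0 a, hcε a⟩
  · obtain ⟨a, ha, haV⟩ := hVp p hp
    refine ⟨c ⟨a, ha⟩, Finset.mem_image_of_mem _ (Finset.mem_univ _), hcx _, fun y hy => haV ?_⟩
    have h1 := abs_eval_sub_eval_le hp (hg01 y) (hg01 (c ⟨a, ha⟩).1)
    have h2 := hcg _ y hy
    rw [hca] at h1 h2
    rw [Metric.mem_closedBall, Real.dist_eq]
    calc |p.eval (g y) - p.eval a| ≤ (d + 1) * (m * d) * |g y - a| := h1
      _ ≤ L * (ρ / L) := by
          gcongr
          linarith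
      _ = ρ := by field_simp

/-- The measure budget `ε` is shared among the nodes of the level, whose number is known before `V`
is chosen. -/
theorem exists_next_finset_balls [SecondCountableTopology X] {g : X → ℝ} (hg : Continuous g)
    (hg01 : ∀ x, g x ∈ Icc (0 : ℝ) 1) {d : ℕ} (hd : 0 < d) (m : ℕ) {ε : ℝ} (hε : 0 < ε)
    (F : {F : Finset (X × ℝ) // ∀ c ∈ F, c.1 ∈ thickPoints g ∧ 0 < c.2}) :
    ∃ F' : {F : Finset (X × ℝ) // ∀ c ∈ F, c.1 ∈ thickPoints g ∧ 0 < c.2}, ∃ V : Set ℝ,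
      IsClosed V ∧ volume V ≤ ENNReal.ofReal ε ∧ (∀ c ∈ F'.1, c.2 ≤ ε) ∧
      ∀ p ∈ boundedPolys d m, ∀ c ∈ F.1, ∃ c' ∈ F'.1,
        Metric.closedBall c'.1 c'.2 ⊆ Metric.closedBall c.1 c.2 ∧
        ∀ y ∈ Metric.closedBall c'.1 c'.2, p.eval (g y) ∈ V := by
  classical
  obtain ⟨F, hF⟩ := F
  have hN : (0 : ℝ) < F.card + 1 := by positivity
  choose F' V hV hVε hF' hp using fun c : F => exists_finset_balls_of_mem_thickPoints hg hg01
    (hF c c.2).1 (hF c c.2).2 hd m (ε := ε / (F.card + 1)) (by positivity)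
  refine ⟨⟨Finset.univ.biUnion F', fun b hb => ?_⟩, ⋃ c, V c, isClosed_iUnion_of_finite hV,
    ?_, fun b hb => ?_, fun p hpb c hc => ?_⟩
  · obtain ⟨c, -, hc⟩ := Finset.mem_biUnion.1 hb
    exact ⟨(hF' c b hc).1, (hF' c b hc).2.1⟩
  · calc volume (⋃ c, V c) ≤ ∑ c, volume (V c) := measure_iUnion_fintype_le _ _
      _ ≤ ∑ _c : F, ENNReal.ofReal (ε / (F.card + 1)) := Finset.sum_le_sum fun c _ => hVε c
      _ = ENNReal.ofReal (F.card * (ε / (F.card + 1))) := by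
          rw [Finset.sum_const, Finset.card_univ, Fintype.card_coe, nsmul_eq_mul,
            ENNReal.ofReal_mul (by positivity), ENNReal.ofReal_natCast]
      _ ≤ ENNReal.ofReal ε := by
          refine ENNReal.ofReal_le_ofReal ?_
          rw [mul_div_assoc', div_le_iff₀ hN]
          linarith
  · obtain ⟨c, -, hc⟩ := Finset.mem_biUnion.1 hb
    exact (hF' c b hc).2.2.trans (div_le_self hε.le (by linarith [F.card.cast_nonneg (α := ℝ)]))
  · obtain ⟨c', hc', hsub, hy⟩ := hp ⟨c, hc⟩ p hpb
    exact ⟨c', Finset.mem_biUnion.2 ⟨_, Finset.mem_univ _, hc'⟩, hsub,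
      fun y hyc => mem_iUnion.2 ⟨_, hy y hyc⟩⟩

theorem exists_mem_iInter_closedBall [CompleteSpace X] {c : ℕ → X × ℝ} (h0 : ∀ n, 0 < (c n).2)
    (hlim : ∀ n, (c (n + 1)).2 ≤ (1 / 2) ^ n)
    (hsub : ∀ n, Metric.closedBall (c (n + 1)).1 (c (n + 1)).2 ⊆
      Metric.closedBall (c n).1 (c n).2) :
    ∃ x, ∀ n, x ∈ Metric.closedBall (c n).1 (c n).2 := by
  have hanti : Antitone fun n => Metric.closedBall (c n).1 (c n).2 := antitone_nat_of_succ_le hsub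
  obtain ⟨x, hx⟩ := Metric.nonempty_iInter_of_nonempty_biInter
    (s := fun n => Metric.closedBall (c n).1 (c n).2) (fun n => Metric.isClosed_closedBall)
    (fun n => Metric.isBounded_closedBall)
    (fun N => ⟨(c N).1, mem_iInter₂.2 fun n hn =>
      hanti hn (Metric.mem_closedBall_self (h0 N).le)⟩) (by
      rw [← tendsto_add_atTop_iff_nat 1]
      refine squeeze_zero (fun _ => Metric.diam_nonneg) (g := fun n : ℕ => 2 * (1 / 2 : ℝ) ^ n)
        (fun n => (Metric.diam_closedBall (h0 _).le).trans (by gcongr; exact hlim n)) ?_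
      simpa using (tendsto_pow_atTop_nhds_zero_of_lt_one (r := (1 / 2 : ℝ)) (by norm_num)
        (by norm_num)).const_mul 2)
  exact ⟨x, mem_iInter.1 hx⟩

/-- A set with a non-`σ`-log-sparse continuous parametrisation has a closed null set meeting its
image under every polynomial of a bounded family. -/
theorem exists_closed_null_meeting_images [SecondCountableTopology X] [CompleteSpace X]
    {g : X → ℝ} (hg : Continuous g) (hg01 : ∀ x, g x ∈ Icc (0 : ℝ) 1)
    (hthick : ¬ IsSigmaLogSparse (range g)) {d : ℕ} (hd : 0 < d) (m : ℕ) :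
    ∃ B : Set ℝ, IsClosed B ∧ volume B = 0 ∧
      ∀ p ∈ boundedPolys d m, ∃ x, p.eval (g x) ∈ B := by
  obtain ⟨x₀, hx₀⟩ : (thickPoints g).Nonempty := by
    by_contra hne
    refine hthick ((isSigmaLogSparse_image_compl_thickPoints g).mono ?_)
    rw [not_nonempty_iff_eq_empty.1 hne, compl_empty, image_univ]
  choose next V hV hVε hε hnext using fun n : ℕ => exists_next_finset_balls hg hg01 hd m
    (ε := (1 / 2) ^ n) (by positivity)
  -- The levels, and hence the closed set, are independent of the polynomial; only the branch below
  -- depends on it.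
  let F : ℕ → {F : Finset (X × ℝ) // ∀ c ∈ F, c.1 ∈ thickPoints g ∧ 0 < c.2} := fun n =>
    Nat.rec ⟨{(x₀, 1)}, by simp [hx₀]⟩ next n
  refine ⟨⋂ n, V n (F n), isClosed_iInter fun n => hV _ _, ?_, fun p hp => ?_⟩
  · refine le_antisymm (ge_of_tendsto' (f := fun n : ℕ => ENNReal.ofReal ((1 / 2 : ℝ) ^ n))
      (x := atTop) ?_ fun n => ?_) bot_le
    · rw [← ENNReal.ofReal_zero]
      exact ENNReal.tendsto_ofReal
        (tendsto_pow_atTop_nhds_zero_of_lt_one (by norm_num) (by norm_num))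
    · exact (measure_mono (iInter_subset _ n)).trans (hVε _ _)
  · have hstep : ∀ (n : ℕ) (c : {c // c ∈ (F n).1}), ∃ c' : {c // c ∈ (F (n + 1)).1},
        Metric.closedBall c'.1.1 c'.1.2 ⊆ Metric.closedBall c.1.1 c.1.2 ∧
        ∀ y ∈ Metric.closedBall c'.1.1 c'.1.2, p.eval (g y) ∈ V n (F n) := by
      intro n c
      obtain ⟨c', hc', h⟩ := hnext n (F n) p hp c.1 c.2
      exact ⟨⟨c', hc'⟩, h⟩
    choose nx hsub hmem using hstep
    let c : (n : ℕ) → {c // c ∈ (F n).1} := fun n =>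
      Nat.rec ⟨(x₀, 1), Finset.mem_singleton_self _⟩ nx n
    obtain ⟨x, hx⟩ := exists_mem_iInter_closedBall (c := fun n => (c n).1)
      (fun n => ((F n).2 _ (c n).2).2) (fun n => hε n (F n) _ (c (n + 1)).2)
      (fun n => hsub n (c n))
    exact ⟨x, mem_iInter.2 fun n => hmem n (c n) x (hx (n + 1))⟩

end Tree

/-! ### Passage to all non-constant polynomials -/

theorem exists_mem_boundedPolys {p : ℝ[X]} (hp : 0 < p.natDegree) :
    ∃ m, p ∈ boundedPolys p.natDegree m := by
  have hlead : 0 < |p.leadingCoeff| :=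
    abs_pos.2 (leadingCoeff_ne_zero.2 fun h => by simp [h] at hp)
  obtain ⟨m, hm⟩ := exists_nat_ge
    (max (∑ i ∈ p.support, |p.coeff i|) (1 / |p.leadingCoeff|))
  refine ⟨m, rfl, fun i => ?_, ?_⟩
  · refine le_trans ?_ ((le_max_left _ _).trans hm)
    by_cases hi : i ∈ p.support
    · exact Finset.single_le_sum (f := fun i => |p.coeff i|) (fun _ _ => abs_nonneg _) hi
    · rw [notMem_support_iff.1 hi, abs_zero]
      exact Finset.sum_nonneg fun _ _ => abs_nonneg _
  · rw [← div_le_iff₀ hlead]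
    exact (le_max_right _ _).trans hm

theorem MeasurableSet.exists_continuous_range_eq {A : Set ℝ} (hA : MeasurableSet A)
    (hne : A.Nonempty) : ∃ g : (ℕ → ℕ) → ℝ, Continuous g ∧ range g = A := by
  have h := hA.analyticSet
  rw [AnalyticSet] at h
  exact h.resolve_left hne.ne_empty

theorem mainTheorem5 (A : Set ℝ) (hA : A ⊆ Set.Icc 0 1) (hAm : MeasurableSet A)
    (hdim : 2 < packingLogDim A ∨ 1 < hausdorffLogDim A) :
    ∃ B : Set ℝ, IsFSigma B ∧ volume B = 0 ∧
      ∀ f : Polynomial ℝ, 0 < f.natDegree → (fun x => f.eval x) '' A + B = Set.univ := by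
  have hsp := not_isSigmaLogSparse_of_logDim hdim
  have hne : A.Nonempty := by
    rw [nonempty_iff_ne_empty]
    rintro rfl
    exact hsp isLogSparse_empty.isSigmaLogSparse
  obtain ⟨g, hg, rfl⟩ := hAm.exists_continuous_range_eq hne
  -- Nested balls need a complete metric inducing the topology of Baire space.
  let := TopologicalSpace.upgradeIsCompletelyMetrizable (ℕ → ℕ)
  -- The index `k` codes a pair: the degree minus one, and the coefficient bound.
  choose B hBc hB0 hB using fun k : ℕ => exists_closed_null_meeting_images hg
    (fun x => hA ⟨x, rfl⟩) hsp (d := k.unpair.1 + 1) (Nat.succ_pos _) k.unpair.2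
  refine ⟨⋃ k, B k, ⟨B, hBc, rfl⟩, measure_iUnion_null hB0, fun f hf => ?_⟩
  refine eq_univ_of_forall fun t => ?_
  have hdeg : (C t - f).natDegree = f.natDegree := by
    rw [natDegree_sub, natDegree_sub_C]
  -- A point `x` with `t - f (g x) ∈ B k` writes `t` as an element of `f(A) + B k`.
  obtain ⟨m, hm⟩ := exists_mem_boundedPolys (p := C t - f) (by rwa [hdeg])
  obtain ⟨x, hx⟩ := hB (Nat.pair ((C t - f).natDegree - 1) m) (C t - f) (by
    rw [Nat.unpair_pair, Nat.sub_add_cancel (by omega)]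
    exact hm)
  refine Set.mem_add.2 ⟨f.eval (g x), ⟨g x, ⟨x, rfl⟩, rfl⟩, _, mem_iUnion.2 ⟨_, hx⟩, ?_⟩
  simp
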